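/- All rings are associative with identity and all modules are left modules. A ring $R$ is left coherent if every finitely generated left ideal of $R$ is finitely presented. For a complex $P_\bullet=(P_i,d_i\colon P_i\to P_{i-1})_{i\in\mathbb Z}$ of $R$-modules put $\sup(P_\bullet)=\sup\{i\mid P_i\neq 0\}$ and $\mathrm{hsup}(P_\bullet)=\sup\{i\mid H_i(P_\bullet)\neq 0\}$. A finite quasi-projective resolution of an $R$-module $M$ is a bounded complex $P_\bullet$ of projective $R$-modules for which there are integers $n_j\ge 0$ $(j\in\mathbb Z)$, not all zero, with $H_j(P_\bullet)\cong M^{n_j}$ for all $j$. The quasi-projective dimension $\mathrm{qpd}_R(M)\in\mathbb N\cup\{\infty\}$ of a nonzero module $M$ is the infimum of $\sup(P_\bullet)-\mathrm{hsup}(P_\bullet)$ over all finite quasi-projective resolutions $P_\bullet$ of $M$ ($\infty$ if there are none), and $\mathrm{qpd}_R(0)=0$. Let $\mathrm{pd}_R$ denote projective dimension, with the convention $\mathrm{pd}_R(0)=0$. Corollary 2.3. Let $R$ be a left coherent ring and $M$ a finitely presented $R$-module with $\mathrm{qpd}_R(M)<\infty$. Then: (1) There exists a bounded complex $P_\bullet$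 of finitely generated projective $R$-modules that is a quasi-projective resolution of $M$ and, if $M\neq 0$, satisfies $\mathrm{qpd}_R(M)=\sup(P_\bullet)-\mathrm{hsup}(P_\bullet)$. (2) There exist a finitely presented $R$-module $N$ with $\mathrm{pd}_R(N)=\mathrm{qpd}_R(M)$ and an injective $R$-linear map $M\hookrightarrow N$. -/

import Mathlib

open CategoryTheory CategoryTheory.Limits

universe u v

noncomputable section

namespace QuasiProjective

/-- A ring `R` is left coherent if every finitely generated left ideal of `R` is finitely
presented as a left `R`-module. (`Ideal R` is the type of left ideals.) -/
def IsLeftCoherent (R : Type u) [Ring R] : Prop :=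
  ∀ I : Ideal R, I.FG → Module.FinitePresentation R I

section Complexes

attribute [local instance] Abelian.hasFiniteBiproducts

variable {A : Type u} [Category.{v} A] [Abelian A]

/-- `X_i = 0` for all sufficiently small `i`, that is, `inf X > -∞`. -/
def IsBoundedBelow (X : ChainComplex A ℤ) : Prop :=
  ∃ a : ℤ, ∀ i : ℤ, i < a → IsZero (X.X i)

/-- `X_i = 0` for all sufficiently large `i`, that is, `sup X < ∞`. -/
def IsBoundedAbove (X : ChainComplex A ℤ) : Prop :=
  ∃ b : ℤ, ∀ i : ℤ, b < i → IsZero (X.X i)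

/-- The supremum `sup X = sup {i | X_i ≠ 0}` of a complex. It is only used for complexes for
which this set is nonempty and bounded above, where `sSup` is the maximum of the set. -/
def complexSup (X : ChainComplex A ℤ) : ℤ :=
  sSup {i : ℤ | ¬ IsZero (X.X i)}

/-- The homological supremum `hsup X = sup {i | H_i(X) ≠ 0}` of a complex. It is only used for
complexes for which this set is nonempty and bounded above. -/
def complexHSup (X : ChainComplex A ℤ) : ℤ :=
  sSup {i : ℤ | ¬ IsZero (X.homology i)}

/-- A quasi-projective resolution of `M`: a bounded below complex of projective objects such that
`H_j(P) ≅ M ^ (n j)` for all `j`, with natural numbers `n j` that are not all zero.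
(Below `inf P` the homology vanishes, so there one can take `n j = 0`.) -/
structure IsQuasiProjectiveResolution (P : ChainComplex A ℤ) (M : A) : Prop where
  boundedBelow : IsBoundedBelow P
  projective : ∀ i : ℤ, Projective (P.X i)
  homology : ∃ n : ℤ → ℕ, (∃ j : ℤ, n j ≠ 0) ∧
    ∀ j : ℤ, Nonempty (P.homology j ≅ ⨁ (fun _ : Fin (n j) => M))

/-- A finite quasi-projective resolution: one that is moreover bounded above. -/
structure IsFiniteQuasiProjectiveResolution (P : ChainComplex A ℤ) (M : A) : Prop
    extends IsQuasiProjectiveResolution P M where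
  boundedAbove : IsBoundedAbove P

open scoped Classical in
/-- The quasi-projective dimension of `M`: it is `0` if `M = 0`, and otherwise the infimum of
`sup P - hsup P` over the finite quasi-projective resolutions `P` of `M` (`⊤` if there are none).
For `M ≠ 0` the difference `sup P - hsup P` is always a natural number `k`. -/
def qpd (M : A) : ℕ∞ :=
  if IsZero M then 0
  else sInf {d : ℕ∞ | ∃ (P : ChainComplex A ℤ) (k : ℕ),
    IsFiniteQuasiProjectiveResolution P M ∧ complexSup P - complexHSup P = (k : ℤ) ∧ d = k}

/-- The projective dimension, with the convention that the zero object has projective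
dimension `0` (Mathlib's `projectiveDimension` is `⊥` there). -/
def pd (M : A) : ℕ∞ :=
  (projectiveDimension M).unbotD 0

end Complexes

end QuasiProjective

end

/-! Take a quasi-projective resolution `P` attaining `qpd M`. Its homology modules are finite powers
of `M`, hence finitely presented, so over a coherent ring `P` can be made finitely generated degree
by degree from below: `exists_quasiIso_replace` puts a finite free module in degree `n` without
changing homology and disturbs only degree `n + 1` besides. The range of degrees does not grow, so
the new complex `X` still attains `qpd M = k`.

Let `h = hsup X` and `N = coker (X_{h+1} → X_h)`, the opcycles. Then `M` embeds in `H_h(X)`, a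
nonzero power of `M`, and `H_h(X)` embeds in `N`. Above degree `h` the complex is exact, so it is a
projective resolution of `N` of length at most `k`. Were `pd N` smaller, a syzygy would already be
projective, and truncating there would give a shorter quasi-projective resolution, against
minimality (`pd_opcycles`). -/

noncomputable section

/-! ### Discs, and changing one degree of a complex of projectives. -/

namespace HomologicalComplex

section Double

variable {C : Type*} [Category* C] [HasZeroMorphisms C] [HasZeroObject C]
  {ι : Type*} {c : ComplexShape ι} {i₀ i₁ : ι} (hi₀₁ : c.Rel i₀ i₁) (h : i₀ ≠ i₁)
  {K : HomologicalComplex C c} {Y : C} (φ : K.X i₁ ⟶ Y)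

open scoped Classical in
/-- The morphism to the disc `double (𝟙 Y)` determined by its component in the lower degree. -/
def mkHomToDoubleId : K ⟶ double (𝟙 Y) hi₀₁ where
  f k :=
    if hk₁ : k = i₁ then
      eqToHom (by rw [hk₁]) ≫ φ ≫ (doubleXIso₁ (𝟙 Y) hi₀₁ h).inv ≫ eqToHom (by rw [hk₁])
    else if hk₀ : k = i₀ then
      eqToHom (by rw [hk₀]) ≫ K.d i₀ i₁ ≫ φ ≫ (doubleXIso₀ (𝟙 Y) hi₀₁).inv ≫
        eqToHom (by rw [hk₀])
    else 0
  comm' k₀ k₁ hk := by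
    by_cases h₁ : k₁ = i₁
    · subst h₁
      obtain rfl := c.prev_eq hk hi₀₁
      simp [dif_neg h, double_d _ hi₀₁ h]
    · by_cases h₀ : k₁ = i₀
      · subst h₀
        rw [double_d_eq_zero₁ _ _ _ _ h, comp_zero, dif_neg h, dif_pos rfl]
        simp
      · exact (isZero_double_X _ hi₀₁ k₁ h₀ h₁).eq_of_tgt _ _

@[simp]
lemma mkHomToDoubleId_f₁ :
    (mkHomToDoubleId hi₀₁ h φ).f i₁ = φ ≫ (doubleXIso₁ (𝟙 Y) hi₀₁ h).inv := by
  simp [mkHomToDoubleId]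

@[simp]
lemma mkHomToDoubleId_f₀ :
    (mkHomToDoubleId hi₀₁ h φ).f i₀ = K.d i₀ i₁ ≫ φ ≫ (doubleXIso₀ (𝟙 Y) hi₀₁).inv := by
  simp [mkHomToDoubleId, dif_neg h]

end Double

section Abelian

variable {A : Type*} [Category* A] [Abelian A] {ι : Type*} {c : ComplexShape ι} {i₀ i₁ : ι}

lemma acyclic_double_id (hi₀₁ : c.Rel i₀ i₁) (h : i₀ ≠ i₁) (Y : A) :
    (double (𝟙 Y) hi₀₁).Acyclic := by
  have hiso : IsIso ((double (𝟙 Y) hi₀₁).d i₀ i₁) := by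
    rw [double_d _ hi₀₁ h]; infer_instance
  intro i
  by_cases h₀ : i = i₀
  · subst h₀
    rw [exactAt_iff' _ (c.prev i) i i₁ rfl (c.next_eq' hi₀₁),
      ShortComplex.exact_iff_mono _ (double_d_eq_zero₁ _ hi₀₁ _ _ h)]
    exact inferInstanceAs (Mono ((double (𝟙 Y) hi₀₁).d i i₁))
  by_cases h₁ : i = i₁
  · subst h₁
    rw [exactAt_iff' _ i₀ i (c.next i) (c.prev_eq' hi₀₁) rfl,
      ShortComplex.exact_iff_epi _ (double_d_eq_zero₀ _ hi₀₁ _ _ h.symm)]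
    exact inferInstanceAs (Epi ((double (𝟙 Y) hi₀₁).d i₀ i))
  exact ExactAt.of_isZero (isZero_double_X _ hi₀₁ i h₀ h₁)

lemma quasiIso_biprod_fst (K L : HomologicalComplex A c) (hL : L.Acyclic) :
    QuasiIso (biprod.fst : K ⊞ L ⟶ K) := by
  rw [quasiIso_iff]
  intro i
  rw [quasiIsoAt_iff_isIso_homologyMap]
  refine ⟨homologyMap biprod.inl i, ?_, ?_⟩
  · have h0 : homologyMap (biprod.snd : K ⊞ L ⟶ L) i = 0 :=
      (hL i).isZero_homology.eq_of_tgt _ _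
    have := congrArg (fun f => homologyMap f i) (biprod.total (X := K) (Y := L))
    simp only [homologyMap_add, homologyMap_comp, homologyMap_id, h0, zero_comp, add_zero] at this
    exact this
  · rw [← homologyMap_comp, biprod.inl_fst, homologyMap_id]

lemma quasiIso_f_of_shortExact {S : ShortComplex (ChainComplex A ℤ)} (hS : S.ShortExact)
    (h : S.X₃.Acyclic) : QuasiIso S.f := by
  rw [quasiIso_iff]
  intro i
  rw [quasiIsoAt_iff_isIso_homologyMap]
  have h₁ := (hS.homology_exact₁ (i + 1) i (by simp)).mono_g
    ((h (i + 1)).isZero_homology.eq_of_src _ _)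
  have h₂ := (hS.homology_exact₂ i).epi_f ((h i).isZero_homology.eq_of_tgt _ _)
  dsimp at h₁ h₂
  exact isIso_of_mono_of_epi _

lemma _root_.CategoryTheory.IsPullback.shortExact_of_epi_desc {X₁ X₂ X₃ X₄ : A} {t : X₁ ⟶ X₂}
    {l : X₁ ⟶ X₃} {r : X₂ ⟶ X₄} {b : X₃ ⟶ X₄} (sq : IsPullback t l r b)
    (hcancel : ∀ {T : A} (z : X₄ ⟶ T), r ≫ z = 0 → b ≫ z = 0 → z = 0) :
    (ShortComplex.mk (biprod.lift t l) (biprod.desc r (-b)) (by simp [sq.w])).ShortExact where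
  exact := sq.exact_shortComplex'
  mono_f := sq.mono_shortComplex'_f
  epi_g := Preadditive.epi_of_cancel_zero _ fun z hz => by
    refine hcancel z ?_ ?_
    · simpa using biprod.inl ≫= hz
    · simpa using biprod.inr ≫= hz

/-- In a complex of projectives, the object in degree `n` may be replaced by any projective
`F` that, together with the boundaries, covers it; only the degrees `n` and `n + 1` change. -/
lemma exists_quasiIso_replace (X : ChainComplex A ℤ) (hX : ∀ i, Projective (X.X i)) {n m : ℤ}
    (hnm : m = n + 1) {F : A} [Projective F] (p : F ⟶ X.X n) [Epi (biprod.desc (X.d m n) p)] :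
    ∃ (X' : ChainComplex A ℤ) (π : X' ⟶ X), QuasiIso π ∧ (∀ i, Projective (X'.X i)) ∧
      (∀ i, i ≠ n → i ≠ m → IsIso (π.f i)) ∧ Nonempty (X'.X n ≅ F) := by
  have hrel : (ComplexShape.down ℤ).Rel m n := by simp [hnm]
  have hne : m ≠ n := by omega
  let D := double (𝟙 F) hrel
  let E := double (𝟙 (X.X n)) hrel
  let α : X ⟶ E := mkHomToDoubleId hrel hne (𝟙 _)
  let β : D ⟶ E := mkHomToDoubleId hrel hne ((doubleXIso₁ (𝟙 F) hrel hne).hom ≫ p)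
  have sq := IsPullback.of_hasPullback α β
  have hsq (i : ℤ) : IsPullback ((pullback.fst α β).f i) ((pullback.snd α β).f i) (α.f i)
      (β.f i) := sq.map (eval A _ i)
  have hαn : IsIso (α.f n) := by
    simp only [α, mkHomToDoubleId_f₁]; infer_instance
  have hepi (i : ℤ) : Epi (biprod.desc (α.f i) (β.f i)) := by
    by_cases h₁ : i = n
    · subst h₁
      have : biprod.inl ≫ biprod.desc (α.f i) (β.f i) = α.f i := by simp
      have h' : Epi (biprod.inl ≫ biprod.desc (α.f i) (β.f i)) := by rw [this]; infer_instance
      exact epi_of_epi biprod.inl _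
    by_cases h₀ : i = m
    · subst h₀
      -- Degree `m` is where the covering hypothesis on `p` enters: up to isomorphism the map is
      -- `(d, p)`.
      have : biprod.desc (α.f i) (β.f i) =
          biprod.map (𝟙 _) (doubleXIso₀ (𝟙 F) hrel).hom ≫ biprod.desc (X.d i n) p ≫
            (doubleXIso₀ (𝟙 (X.X n)) hrel).inv := by
        ext <;> simp [α, β, D, double_d _ hrel hne]
      rw [this]
      infer_instance
    · exact ⟨fun _ _ _ => (isZero_double_X _ hrel i h₀ h₁).eq_of_src _ _⟩
  have hDproj (i : ℤ) : Projective (D.X i) := by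
    by_cases h₁ : i = n
    · subst h₁
      exact Projective.of_iso (doubleXIso₁ (𝟙 F) hrel hne).symm inferInstance
    by_cases h₀ : i = m
    · subst h₀
      exact Projective.of_iso (doubleXIso₀ (𝟙 F) hrel).symm inferInstance
    · exact Projective.of_iso (isZero_double_X (𝟙 F) hrel i h₀ h₁).isoZero.symm inferInstance
  have hEproj (i : ℤ) : Projective (E.X i) := by
    by_cases h₁ : i = n
    · subst h₁
      exact Projective.of_iso (doubleXIso₁ (𝟙 (X.X i)) hrel hne).symm (hX i)
    by_cases h₀ : i = m
    · subst h₀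
      exact Projective.of_iso (doubleXIso₀ (𝟙 (X.X n)) hrel).symm (hX n)
    · exact Projective.of_iso (isZero_double_X (𝟙 (X.X n)) hrel i h₀ h₁).isoZero.symm
        inferInstance
  have hcancel (i : ℤ) {T : A} (z : E.X i ⟶ T) (h₁ : α.f i ≫ z = 0) (h₂ : β.f i ≫ z = 0) :
      z = 0 := by
    rw [← cancel_epi (biprod.desc (α.f i) (β.f i))]
    ext <;> simp [h₁, h₂]
  have hT := sq.shortExact_of_epi_desc fun z h₁ h₂ => by
    refine HomologicalComplex.hom_ext _ _ fun i => ?_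
    refine hcancel i _ ?_ ?_
    · rw [← comp_f, h₁, zero_f]
    · rw [← comp_f, h₂, zero_f]
  refine ⟨pullback α β, pullback.fst α β, ?_, fun i => ?_, fun i h₁ h₀ => ?_, ?_⟩
  -- The projection to `X` factors through `X ⊞ D`; both factors are quasi-isomorphisms since the
  -- discs `E` and `D` are acyclic.
  · have q₁ : QuasiIso (biprod.lift (pullback.fst α β) (pullback.snd α β)) :=
      quasiIso_f_of_shortExact hT (acyclic_double_id hrel hne _)
    have q₂ := quasiIso_biprod_fst X D (acyclic_double_id hrel hne _)
    rw [← biprod.lift_fst (pullback.fst α β) (pullback.snd α β)]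
    infer_instance
  · have h₂ : Projective (X.X i ⊞ D.X i) := by
      have := hX i; have := hDproj i
      infer_instance
    have h₃ := hEproj i
    -- The kernel of an epimorphism between projectives is projective.
    exact projective_iff_hasProjectiveDimensionLT_one.2
      (((hsq i).shortExact_of_epi_desc (hcancel i)).hasProjectiveDimensionLT_X₁ 1
        (inferInstanceAs (HasProjectiveDimensionLT (X.X i ⊞ D.X i) 1))
        (inferInstanceAs (HasProjectiveDimensionLT (E.X i) 2)))
  · have : IsIso (β.f i) :=
      ⟨0, (isZero_double_X (𝟙 F) hrel i h₀ h₁).eq_of_src _ _,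
        (isZero_double_X (𝟙 (X.X n)) hrel i h₀ h₁).eq_of_src _ _⟩
    exact (hsq i).isIso_fst_of_isIso
  · have : IsIso ((pullback.snd α β).f n) := (hsq n).isIso_snd_of_isIso
    exact ⟨asIso ((pullback.snd α β).f n) ≪≫ doubleXIso₁ (𝟙 F) hrel hne⟩

end Abelian

end HomologicalComplex

/-! ### Finiteness over a coherent ring. -/

namespace QuasiProjective

section Coherent

variable {R : Type u} [Ring R]

/-- Induction on `k`: the first coordinate maps `N` onto a finitely generated left ideal, and the
kernel embeds in `R^(k-1)`. -/
lemma IsLeftCoherent.finitePresentation_submodule_pi (hR : IsLeftCoherent R) :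
    ∀ (k : ℕ) (N : Submodule R (Fin k → R)), N.FG → Module.FinitePresentation R N
  | 0, N, _ => Module.finitePresentation_of_projective R N
  | k + 1, N, hN => by
    let f : N →ₗ[R] R := LinearMap.proj 0 ∘ₗ N.subtype
    have : Module.Finite R N := Module.Finite.of_fg hN
    have hfp : Module.FinitePresentation R (LinearMap.range f) := hR _ (Submodule.fg_range f)
    have hl := LinearMap.surjective_rangeRestrict f
    have hker : Module.Finite R (LinearMap.ker f.rangeRestrict) :=
      Module.Finite.of_fg (Module.FinitePresentation.fg_ker _ hl)
    let g : LinearMap.ker f.rangeRestrict →ₗ[R] (Fin k → R) :=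
      LinearMap.funLeft R R Fin.succ ∘ₗ N.subtype ∘ₗ (LinearMap.ker f.rangeRestrict).subtype
    have hg : Function.Injective g := by
      rw [injective_iff_map_eq_zero]
      rintro ⟨⟨x, hxN⟩, hx⟩ h
      have h0 : x 0 = 0 := congrArg Subtype.val (LinearMap.mem_ker.1 hx)
      ext i
      refine Fin.cases h0 (fun j => congrFun h j) i
    have := hR.finitePresentation_submodule_pi k (LinearMap.range g) (Submodule.fg_range g)
    have : Module.FinitePresentation R (LinearMap.ker f.rangeRestrict) :=
      Module.FinitePresentation.of_equiv (R := R) (M := LinearMap.range g)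
        (N := LinearMap.ker f.rangeRestrict) (LinearEquiv.ofInjective g hg).symm
    exact Module.finitePresentation_of_ker _ hl

lemma IsLeftCoherent.fg_ker (hR : IsLeftCoherent R) {M N : Type*} [AddCommGroup M] [Module R M]
    [AddCommGroup N] [Module R N] [Module.Finite R M] [Module.Finite R N] [Module.Projective R N]
    (f : M →ₗ[R] N) : (LinearMap.ker f).FG := by
  obtain ⟨k, p, hp⟩ := Module.Finite.exists_fin' R N
  obtain ⟨s, hs⟩ := Module.projective_lifting_property p LinearMap.id hp
  have hsinj : LinearMap.ker s = ⊥ :=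
    LinearMap.ker_eq_bot.2 (Function.LeftInverse.injective (DFunLike.congr_fun hs))
  -- The splitting `s` embeds `N` in a free module without changing the kernel of `f`.
  have := hR.finitePresentation_submodule_pi k (LinearMap.range (s ∘ₗ f)) (Submodule.fg_range _)
  have h := Module.FinitePresentation.fg_ker (s ∘ₗ f).rangeRestrict
    (LinearMap.surjective_rangeRestrict _)
  rwa [LinearMap.ker_rangeRestrict, LinearMap.ker_comp_of_ker_eq_bot _ hsinj] at h

variable (X : ChainComplex (ModuleCat.{u} R) ℤ)

/-- The opcycles in degree `n` are an extension of the boundaries in `X_m` by `H_n`. Coherence makes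
the cycles in `X_m` finitely generated, and then finite presentation of `H_m` does the same for the
boundaries. -/
lemma IsLeftCoherent.finite_opcycles (hR : IsLeftCoherent R) {n m k : ℤ}
    (hm : m + 1 = n) (hk : k + 1 = m)
    [Module.Finite R (X.X m)] [Module.Finite R (X.X k)] [Module.Projective R (X.X k)]
    [Module.Finite R (X.homology n)] [Module.FinitePresentation R (X.homology m)] :
    Module.Finite R (X.opcycles n) := by
  have hrel : (ComplexShape.down ℤ).Rel n m := by simp [hm]
  have hcyc : Module.Finite R (X.cycles m) := by
    have hnext : (ComplexShape.down ℤ).next m = k := by simp; omega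
    have hmono : Function.Injective (X.iCycles m).hom :=
      (ModuleCat.mono_iff_injective _).1 inferInstance
    have hex : LinearMap.range (X.iCycles m).hom = LinearMap.ker (X.d m k).hom :=
      (ShortComplex.exact_of_f_is_kernel (ShortComplex.mk (X.iCycles m) (X.d m k) (by simp))
        (X.cyclesIsKernel m k hnext)).moduleCat_range_eq_ker
    have : Module.Finite R (LinearMap.range (X.iCycles m).hom) := by
      rw [hex]; exact Module.Finite.of_fg (hR.fg_ker _)
    exact Module.Finite.equiv (LinearEquiv.ofInjective _ hmono).symm
  have hex := HomologicalComplex.HomologySequence.composableArrows₃_exact X n m hrel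
  have h₁ : LinearMap.range (X.homologyι n).hom = LinearMap.ker (X.opcyclesToCycles n m).hom :=
    (hex.exact 0).moduleCat_range_eq_ker
  have h₂ : LinearMap.range (X.opcyclesToCycles n m).hom = LinearMap.ker (X.homologyπ m).hom :=
    (hex.exact 1).moduleCat_range_eq_ker
  refine ⟨Submodule.fg_of_fg_map_of_fg_inf_ker (X.opcyclesToCycles n m).hom ?_ ?_⟩
  · rw [Submodule.map_top, h₂]
    exact Module.FinitePresentation.fg_ker _ ((ModuleCat.epi_iff_surjective _).1 inferInstance)
  · rw [top_inf_eq, ← h₁]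
    exact Submodule.fg_range _

/-- If the opcycles in degree `n` are finitely generated, finitely many elements generate
`X_n` modulo boundaries. -/
lemma exists_epi_desc_of_finite_opcycles (n m : ℤ) (hm : m = n + 1)
    [Module.Finite R (X.opcycles n)] :
    ∃ (k : ℕ) (p : ModuleCat.of R (Fin k → R) ⟶ X.X n), Epi (biprod.desc (X.d m n) p) := by
  obtain ⟨k, q, hq⟩ := Module.Finite.exists_fin' R (X.opcycles n)
  have : Epi (ModuleCat.ofHom q) := (ModuleCat.epi_iff_surjective _).2 hq
  have : Projective (ModuleCat.of R (Fin k → R)) :=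
    (IsProjective.iff_projective _).1 inferInstance
  refine ⟨k, Projective.factorThru (ModuleCat.ofHom q) (X.pOpcycles n), ?_⟩
  refine Preadditive.epi_of_cancel_zero _ fun {T} z hz => ?_
  have h₁ : X.d m n ≫ z = 0 := by simpa using biprod.inl ≫= hz
  have h₂ : Projective.factorThru (ModuleCat.ofHom q) (X.pOpcycles n) ≫ z = 0 := by
    simpa using biprod.inr ≫= hz
  have hm' : (ComplexShape.down ℤ).prev n = m := by simp [hm]
  -- A map killing the boundaries factors through the opcycles, onto which the free module surjects.
  rw [← X.p_descOpcycles z m hm' h₁] at h₂ ⊢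
  rw [Projective.factorThru_comp_assoc] at h₂
  rw [(cancel_epi _).1 (h₂.trans comp_zero.symm), comp_zero]

end Coherent

end QuasiProjective

/-! ### Truncation and dimension shifting. -/

namespace HomologicalComplex

variable {A : Type*} [Category* A] [Abelian A] (X : ChainComplex A ℤ)

/-- The half-line of degrees `≤ p`, as an embedding into the shape of chain complexes. -/
def downEmbedding (p : ℤ) : ComplexShape.Embedding (ComplexShape.up ℕ) (ComplexShape.down ℤ) :=
  ComplexShape.Embedding.mk' _ _ (fun n => p - n) (fun _ _ h => by simpa using h)
    (fun i j => by simp only [ComplexShape.up_Rel, ComplexShape.down_Rel]; omega)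

instance (p : ℤ) : (downEmbedding p).IsTruncGE where
  rel' i j h := by
    have h' : p - (j : ℤ) + 1 = p - i := h
    exact (by omega : i + 1 = j)
  mem_next {j k'} h := ⟨j + 1, by
    have h' : k' + 1 = p - (j : ℤ) := h
    have : p - ((j + 1 : ℕ) : ℤ) = k' := by push_cast; omega
    exact this⟩

lemma downEmbedding_f (p : ℤ) (n : ℕ) : (downEmbedding p).f n = p - n := rfl

/-- A complex of projectives that is exact above degree `p` and has projective cokernel in
degree `p` may be truncated there. -/
lemma exists_quasiIso_truncation (hX : ∀ i, Projective (X.X i)) (p : ℤ)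
    (hp : Projective (X.opcycles p)) (hH : ∀ i, p < i → IsZero (X.homology i)) :
    ∃ (Y : ChainComplex A ℤ) (π : X ⟶ Y), QuasiIso π ∧ (∀ i, Projective (Y.X i)) ∧
      (∀ i, p < i → IsZero (Y.X i)) ∧ (∀ i, i < p → IsZero (X.X i) → IsZero (Y.X i)) := by
  let e := downEmbedding p
  -- Index `0`, that is degree `p`, is the only boundary index: there the truncation has the
  -- opcycles, in lower degrees `X_i` itself.
  have h0 : e.BoundaryGE 0 := by
    refine e.boundaryGE (i' := p + 1) (by simp [e, downEmbedding_f]) fun n => ?_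
    simp only [e, downEmbedding_f]; omega
  have hn (n : ℕ) : ¬ e.BoundaryGE (n + 1) :=
    e.not_boundaryGE_next (j := n) (by simp)
  have hlt (i : ℤ) (hi : i < p) : ∃ n : ℕ, e.f (n + 1) = i :=
    ⟨(p - i - 1).toNat, by simp only [e, downEmbedding_f]; push_cast; omega⟩
  have hzero (i : ℤ) (hi : p < i) (n : ℕ) : e.f n ≠ i := by
    simp only [e, downEmbedding_f]; omega
  refine ⟨X.truncGE e, X.πTruncGE e, ?_, fun i => ?_, fun i hi => ?_, fun i hi hXi => ?_⟩
  · rw [quasiIso_πTruncGE_iff_isSupported]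
    exact ⟨fun i hi => (exactAt_iff_isZero_homology _ _).2 (hH i (by
      by_contra! hle
      exact hi (p - i).toNat (by simp only [e, downEmbedding_f]; omega)))⟩
  · rcases lt_trichotomy i p with hi | rfl | hi
    · obtain ⟨n, hn'⟩ := hlt i hi
      exact Projective.of_iso (X.truncGEXIso e hn' (hn n)).symm (hX i)
    · exact Projective.of_iso
        (X.truncGEXIsoOpcycles e (i := 0) (by simp [e, downEmbedding_f]) h0).symm hp
    · exact Projective.of_iso (isZero_X_of_isStrictlySupported _ e i (hzero i hi)).isoZero.symm
        inferInstance
  · exact isZero_X_of_isStrictlySupported _ e i (hzero i hi)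
  · obtain ⟨n, hn'⟩ := hlt i hi
    exact hXi.of_iso (X.truncGEXIso e hn' (hn n))

/-- Vanishing of `H_{j+1}` makes the opcycles in degree `j + 1` the first syzygy, via `X_j`, of
those in degree `j`. -/
lemma hasProjectiveDimensionLT_opcycles_iff (j : ℤ) (hj : Projective (X.X j))
    (hH : IsZero (X.homology (j + 1))) (n : ℕ) :
    HasProjectiveDimensionLT (X.opcycles j) (n + 2) ↔
      HasProjectiveDimensionLT (X.opcycles (j + 1)) (n + 1) := by
  let S := ShortComplex.mk (X.fromOpcycles (j + 1) j) (X.pOpcycles j) (by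
    simp [← cancel_epi (X.pOpcycles (j + 1))])
  have hS : S.ShortExact :=
    { exact := by
        let S' := ShortComplex.mk (X.d (j + 1) j) (X.pOpcycles j) (by simp)
        let φ : S' ⟶ S := { τ₁ := X.pOpcycles (j + 1), τ₂ := 𝟙 _, τ₃ := 𝟙 _ }
        have : Epi φ.τ₁ := inferInstanceAs (Epi (X.pOpcycles (j + 1)))
        have : IsIso φ.τ₂ := inferInstanceAs (IsIso (𝟙 _))
        have : Mono φ.τ₃ := inferInstanceAs (Mono (𝟙 _))
        rw [← ShortComplex.exact_iff_of_epi_of_isIso_of_mono φ]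
        exact S'.exact_of_g_is_cokernel (X.opcyclesIsCokernel (j + 1) j (by simp))
      mono_f := (ShortComplex.exact_of_f_is_kernel
        (ShortComplex.mk (X.homologyι (j + 1)) (X.fromOpcycles (j + 1) j) (by simp))
        (X.homologyIsKernel (j + 1) j (by simp))).mono_g (hH.eq_of_src _ _)
      epi_g := inferInstanceAs (Epi (X.pOpcycles j)) }
  exact hS.hasProjectiveDimensionLT_X₃_iff n hj

lemma hasProjectiveDimensionLT_opcycles_iff_projective (hX : ∀ i, Projective (X.X i)) (h : ℤ)
    (hH : ∀ i, h < i → IsZero (X.homology i)) (r : ℕ) :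
    HasProjectiveDimensionLT (X.opcycles h) (r + 1) ↔ Projective (X.opcycles (h + r)) := by
  -- The extra `n` leaves room for each induction step to lower the bound by one.
  suffices ∀ (n : ℕ), HasProjectiveDimensionLT (X.opcycles h) (n + r + 1) ↔
      HasProjectiveDimensionLT (X.opcycles (h + r)) (n + 1) by
    simpa [projective_iff_hasProjectiveDimensionLT_one] using this 0
  induction r with
  | zero => simp
  | succ r ih =>
    intro n
    rw [show n + (r + 1) + 1 = (n + 1) + r + 1 by omega, ih (n + 1),
      show h + ((r + 1 : ℕ) : ℤ) = h + r + 1 by push_cast; ring]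
    exact X.hasProjectiveDimensionLT_opcycles_iff _ (hX _) (hH _ (by omega)) n

end HomologicalComplex

/-! ### Passing to finitely generated projectives. -/

namespace QuasiProjective

lemma IsLeftCoherent.exists_quasiIso_finite {R : Type u} [Ring R] (hR : IsLeftCoherent R)
    (P : ChainComplex (ModuleCat.{u} R) ℤ) (hP : ∀ i, Projective (P.X i)) {a s : ℤ} (has : a ≤ s)
    (ha : ∀ i, i < a → IsZero (P.X i)) (hs : ∀ i, s < i → IsZero (P.X i))
    (hH : ∀ i, Module.FinitePresentation R (P.homology i)) :
    ∃ (X : ChainComplex (ModuleCat.{u} R) ℤ) (π : X ⟶ P), QuasiIso π ∧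
      (∀ i, Projective (X.X i)) ∧ (∀ i, Module.Finite R (X.X i)) ∧
      (∀ i, i < a → IsZero (X.X i)) ∧ (∀ i, s < i → IsZero (X.X i)) := by
  have hopc {X : ChainComplex (ModuleCat.{u} R) ℤ} (π : X ⟶ P) (_ : QuasiIso π)
      (hX : ∀ i, Projective (X.X i)) (n : ℤ) (hfin : ∀ i, i < n → Module.Finite R (X.X i)) :
      Module.Finite R (X.opcycles n) := by
    have hHX (i : ℤ) : Module.FinitePresentation R (X.homology i) :=
      .of_equiv (_root_.isoOfQuasiIsoAt π i).symm.toLinearEquiv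
    have := hfin (n - 1) (by omega)
    have := hfin (n - 2) (by omega)
    have : Module.Projective R (X.X (n - 2)) := (IsProjective.iff_projective _).2 (hX _)
    exact hR.finite_opcycles X (n := n) (m := n - 1) (k := n - 2) (by omega) (by omega)
  -- The bound on `t` keeps both altered degrees at most `s`, so nothing appears above `s`.
  have key (t : ℕ) (ht : a + t ≤ s) :
      ∃ (X : ChainComplex (ModuleCat.{u} R) ℤ) (π : X ⟶ P), QuasiIso π ∧
        (∀ i, Projective (X.X i)) ∧ (∀ i, i < a + t → Module.Finite R (X.X i)) ∧
        (∀ i, i < a → IsZero (X.X i)) ∧ (∀ i, s < i → IsZero (X.X i)) := by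
    induction t with
    | zero =>
      refine ⟨P, 𝟙 P, inferInstance, hP, fun i hi => ?_, ha, hs⟩
      have := ModuleCat.subsingleton_of_isZero (ha i (by simpa using hi))
      infer_instance
    | succ t ih =>
      obtain ⟨X, π, hπ, hX, hfin, hXa, hXs⟩ := ih (by push_cast at ht; omega)
      have := hopc π hπ hX (a + t) hfin
      obtain ⟨k, p, hp⟩ := exists_epi_desc_of_finite_opcycles X (a + t) _ rfl
      have : Projective (ModuleCat.of R (Fin k → R)) :=
        (IsProjective.iff_projective _).1 inferInstance
      obtain ⟨X', π', hπ', hX', hiso, ⟨e⟩⟩ := X.exists_quasiIso_replace hX rfl p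
      push_cast at ht
      have hz (i : ℤ) (h₁ : i ≠ a + t) (h₂ : i ≠ a + t + 1) (h : IsZero (X.X i)) :
          IsZero (X'.X i) := by
        have := hiso i h₁ h₂
        exact h.of_iso (asIso (π'.f i))
      refine ⟨X', π' ≫ π, inferInstance, hX', fun i hi => ?_,
        fun i hi => hz i (by omega) (by omega) (hXa i hi),
        fun i hi => hz i (by omega) (by omega) (hXs i hi)⟩
      push_cast at hi
      by_cases h : i = a + t
      · subst h
        exact Module.Finite.equiv e.symm.toLinearEquiv
      · have := hiso i h (by omega)
        have := hfin i (by omega)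
        exact Module.Finite.equiv (asIso (π'.f i)).symm.toLinearEquiv
  obtain ⟨X, π, hπ, hX, hfin, hXa, hXs⟩ := key (s - a).toNat (by omega)
  refine ⟨X, π, hπ, hX, fun i => ?_, hXa, hXs⟩
  rcases lt_trichotomy i s with hi | rfl | hi
  · exact hfin i (by omega)
  -- The top degree needs no replacement: with nothing above it, it equals its own opcycles.
  · have := hopc π hπ hX i (fun j hj => hfin j (by omega))
    have := X.isIso_pOpcycles (i + 1) i (by simp) ((hXs (i + 1) (by omega)).eq_of_src _ _)
    exact Module.Finite.equiv (asIso (X.pOpcycles i)).symm.toLinearEquiv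
  · have := ModuleCat.subsingleton_of_isZero (hXs i hi)
    infer_instance

end QuasiProjective

/-! ### Suprema and minimal resolutions. -/

namespace QuasiProjective

section Abelian

variable {A : Type u} [Category.{v} A] [Abelian A] {M : A} {P Q : ChainComplex A ℤ}

lemma IsQuasiProjectiveResolution.of_homology_iso (hP : IsQuasiProjectiveResolution P M)
    (e : ∀ i, Nonempty (Q.homology i ≅ P.homology i)) (hQ : ∀ i, Projective (Q.X i))
    (hb : IsBoundedBelow Q) : IsQuasiProjectiveResolution Q M where
  boundedBelow := hb
  projective := hQ
  homology := by
    obtain ⟨n, hn, h⟩ := hP.homology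
    exact ⟨n, hn, fun j => ⟨(e j).some ≪≫ (h j).some⟩⟩

lemma complexHSup_congr (e : ∀ i, Nonempty (Q.homology i ≅ P.homology i)) :
    complexHSup Q = complexHSup P := by
  simp only [complexHSup]
  congr 1
  ext i
  exact not_congr (e i).some.isZero_iff

lemma IsQuasiProjectiveResolution.exists_homology_ne_zero (hP : IsQuasiProjectiveResolution P M)
    (hM : ¬ IsZero M) : ∃ i, ¬ IsZero (P.homology i) := by
  obtain ⟨n, ⟨j, hj⟩, h⟩ := hP.homology
  refine ⟨j, fun hz => hM ?_⟩
  have := Abelian.hasFiniteBiproducts (C := A)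
  have : NeZero (n j) := ⟨hj⟩
  have hz' := hz.of_iso (h j).some.symm
  rw [IsZero.iff_id_eq_zero, ← biproduct.ι_π_self (fun _ : Fin (n j) => M) 0,
    hz'.eq_of_tgt (biproduct.ι (fun _ : Fin (n j) => M) 0) 0, zero_comp]

lemma isZero_homology_of_isZero_X {i : ℤ} (h : IsZero (P.X i)) : IsZero (P.homology i) :=
  (HomologicalComplex.ExactAt.of_isZero h).isZero_homology

lemma complexHSup_spec {b : ℤ} (hb : ∀ i, b < i → IsZero (P.homology i))
    (hne : ∃ i, ¬ IsZero (P.homology i)) :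
    ¬ IsZero (P.homology (complexHSup P)) ∧
      ∀ i, complexHSup P < i → IsZero (P.homology i) := by
  have hbdd : BddAbove {i : ℤ | ¬ IsZero (P.homology i)} :=
    ⟨b, fun i hi => not_lt.1 fun h => hi (hb i h)⟩
  exact ⟨Int.csSup_mem hne hbdd, fun i hi => by
    by_contra h
    exact (le_csSup hbdd (show i ∈ {i : ℤ | ¬ IsZero (P.homology i)} from h)).not_gt hi⟩

lemma complexSup_spec {b : ℤ} (hb : ∀ i, b < i → IsZero (P.X i)) (hne : ∃ i, ¬ IsZero (P.X i)) :
    ¬ IsZero (P.X (complexSup P)) ∧ ∀ i, complexSup P < i → IsZero (P.X i) := by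
  have hbdd : BddAbove {i : ℤ | ¬ IsZero (P.X i)} :=
    ⟨b, fun i hi => not_lt.1 fun h => hi (hb i h)⟩
  exact ⟨Int.csSup_mem hne hbdd, fun i hi => by
    by_contra h
    exact (le_csSup hbdd (show i ∈ {i : ℤ | ¬ IsZero (P.X i)} from h)).not_gt hi⟩

/-- A quasi-projective resolution vanishing above `hsup P + k` realises some `k' ≤ k`, which
bounds the quasi-projective dimension. -/
lemma IsQuasiProjectiveResolution.exists_qpd_le (hP : IsQuasiProjectiveResolution P M)
    (hM : ¬ IsZero M) {k : ℕ} (hk : ∀ i, complexHSup P + k < i → IsZero (P.X i)) :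
    ∃ k' : ℕ, k' ≤ k ∧ complexSup P - complexHSup P = (k' : ℤ) ∧ qpd M ≤ k' := by
  have hne := hP.exists_homology_ne_zero hM
  obtain ⟨hH, -⟩ := complexHSup_spec (fun i hi => isZero_homology_of_isZero_X (hk i hi)) hne
  have hX : ¬ IsZero (P.X (complexHSup P)) := fun h => hH (isZero_homology_of_isZero_X h)
  obtain ⟨hS, hS'⟩ := complexSup_spec hk ⟨_, hX⟩
  have h₁ : complexHSup P ≤ complexSup P := not_lt.1 fun h => hX (hS' _ h)
  have h₂ : complexSup P ≤ complexHSup P + k := not_lt.1 fun h => hS (hk _ h)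
  refine ⟨(complexSup P - complexHSup P).toNat, by omega, by omega, ?_⟩
  rw [qpd, if_neg hM]
  exact sInf_le ⟨P, _, ⟨hP, _, hk⟩, by omega, rfl⟩

lemma exists_resolution_qpd_eq (hM : ¬ IsZero M) (h : qpd M ≠ ⊤) :
    ∃ (P : ChainComplex A ℤ) (k : ℕ), IsFiniteQuasiProjectiveResolution P M ∧
      complexSup P - complexHSup P = (k : ℤ) ∧ qpd M = k := by
  rw [qpd, if_neg hM] at h ⊢
  have hmem (S : Set ℕ∞) (hS : sInf S ≠ ⊤) : sInf S ∈ S :=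
    csInf_mem (Set.nonempty_iff_ne_empty.2 fun h' => hS (by rw [h', sInf_empty]))
  have := hmem _ h
  exact this

lemma isFiniteQuasiProjectiveResolution_of_isZero (hM : IsZero M) (h0 : ∀ i, IsZero (P.X i)) :
    IsFiniteQuasiProjectiveResolution P M := by
  have := Abelian.hasFiniteBiproducts (C := A)
  refine ⟨⟨⟨0, fun i _ => h0 i⟩, fun i => Projective.of_iso (h0 i).isoZero.symm inferInstance,
    fun _ => 1, ⟨0, one_ne_zero⟩, fun j => ⟨(isZero_homology_of_isZero_X (h0 j)).iso ?_⟩⟩,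
    ⟨0, fun i _ => h0 i⟩⟩
  rw [IsZero.iff_id_eq_zero]
  exact biproduct.hom_ext _ _ fun _ => hM.eq_of_tgt _ _

/-- The cokernel in homological degree `hsup P` of a minimal quasi-projective resolution has
projective dimension `qpd M`. -/
lemma IsQuasiProjectiveResolution.pd_opcycles (hP : IsQuasiProjectiveResolution P M)
    (hM : ¬ IsZero M) {k : ℕ} (hk : ∀ i, complexHSup P + k < i → IsZero (P.X i))
    (hq : qpd M = k) : pd (P.opcycles (complexHSup P)) = k := by
  obtain ⟨hH, hH'⟩ := complexHSup_spec (fun i hi => isZero_homology_of_isZero_X (hk i hi))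
    (hP.exists_homology_ne_zero hM)
  have hiff := P.hasProjectiveDimensionLT_opcycles_iff_projective hP.projective _ hH'
  suffices projectiveDimension (P.opcycles (complexHSup P)) = k by rw [pd, this]; rfl
  refine le_antisymm ?_ ?_
  · rw [projectiveDimension_le_iff]
    refine (hiff k).2 ?_
    -- Nothing lies above degree `hsup P + k`, so the opcycles there are the projective `P_{hsup P +
    -- k}`.
    have := P.isIso_pOpcycles _ (complexHSup P + k) (by simp)
      ((hk (complexHSup P + k + 1) (by omega)).eq_of_src _ _)
    exact Projective.of_iso (asIso (P.pOpcycles _)) (hP.projective _)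
  · rw [projectiveDimension_ge_iff]
    intro hlt
    -- For `k = 0` the opcycles contain the nonzero top homology; for `k = r + 1` truncation at
    -- `hsup P + r` would give `qpd M ≤ r`.
    cases k with
    | zero =>
      rw [hasProjectiveDimensionLT_zero_iff_isZero] at hlt
      exact hH (IsZero.of_mono (P.homologyι _) hlt)
    | succ r =>
      obtain ⟨Y, π, hπ, hY, hYs, hYz⟩ := P.exists_quasiIso_truncation hP.projective
        (complexHSup P + r) ((hiff r).1 hlt) (fun i hi => hH' i (by omega))
      have e (i : ℤ) : Nonempty (Y.homology i ≅ P.homology i) := ⟨(isoOfQuasiIsoAt π i).symm⟩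
      obtain ⟨a, ha⟩ := hP.boundedBelow
      have hY' : IsQuasiProjectiveResolution Y M := hP.of_homology_iso e hY
        ⟨min a (complexHSup P + r), fun i hi => hYz i (by omega) (ha i (by omega))⟩
      obtain ⟨k', hk', -, hle⟩ := hY'.exists_qpd_le hM (k := r)
        (by rwa [complexHSup_congr e])
      rw [hq, Nat.cast_le] at hle
      omega

end Abelian

section Module

variable {R : Type u} [Ring R]

lemma IsQuasiProjectiveResolution.exists_injective_homology {M : ModuleCat.{u} R}
    {P : ChainComplex (ModuleCat.{u} R) ℤ} (hP : IsQuasiProjectiveResolution P M) {i : ℤ}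
    (hi : ¬ IsZero (P.homology i)) : ∃ f : M →ₗ[R] P.homology i, Function.Injective f := by
  obtain ⟨n, -, h⟩ := hP.homology
  let e : P.homology i ≃ₗ[R] (Fin (n i) → M) :=
    ((h i).some ≪≫ ModuleCat.biproductIsoPi _).toLinearEquiv
  have : NeZero (n i) := ⟨fun h0 => hi <| by
    have : IsEmpty (Fin (n i)) := by rw [h0]; infer_instance
    have := e.toEquiv.subsingleton
    exact ModuleCat.isZero_of_subsingleton _⟩
  exact ⟨e.symm.toLinearMap ∘ₗ LinearMap.single R (fun _ => M) 0,
    e.symm.injective.comp (Pi.single_injective (M := fun _ : Fin (n i) => M) 0)⟩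

lemma IsQuasiProjectiveResolution.finitePresentation_homology {M : ModuleCat.{u} R}
    [Module.FinitePresentation R M] {P : ChainComplex (ModuleCat.{u} R) ℤ}
    (hP : IsQuasiProjectiveResolution P M) (i : ℤ) :
    Module.FinitePresentation R (P.homology i) := by
  obtain ⟨n, -, h⟩ := hP.homology
  let e : P.homology i ≃ₗ[R] (Fin (n i) → M) :=
    ((h i).some ≪≫ ModuleCat.biproductIsoPi _).toLinearEquiv
  exact .of_equiv e.symm

lemma finitePresentation_opcycles (X : ChainComplex (ModuleCat.{u} R) ℤ)
    (hX : ∀ i, Module.Finite R (X.X i) ∧ Module.Projective R (X.X i)) (n : ℤ) :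
    Module.FinitePresentation R (X.opcycles n) := by
  have hfin (i : ℤ) := (hX i).1
  have := (hX n).2
  have := Module.finitePresentation_of_projective R (X.X n)
  refine Module.finitePresentation_of_surjective (X.pOpcycles n).hom
    ((ModuleCat.epi_iff_surjective _).1 inferInstance) ?_
  have hex : LinearMap.range (X.d (n + 1) n).hom = LinearMap.ker (X.pOpcycles n).hom :=
    (ShortComplex.exact_of_g_is_cokernel (ShortComplex.mk (X.d (n + 1) n) (X.pOpcycles n) (by simp))
      (X.opcyclesIsCokernel (n + 1) n (by simp))).moduleCat_range_eq_ker
  rw [← hex]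
  exact Submodule.fg_range _

end Module

end QuasiProjective

end

/-! ### The main theorem. -/

theorem corollary2p3 {R : Type u} [Ring R] (hR : QuasiProjective.IsLeftCoherent R)
    (M : Type u) [AddCommGroup M] [Module R M] (hM : Module.FinitePresentation R M)
    (hqpd : QuasiProjective.qpd (ModuleCat.of R M) ≠ ⊤) :
    (∃ P : ChainComplex (ModuleCat.{u} R) ℤ,
      QuasiProjective.IsFiniteQuasiProjectiveResolution P (ModuleCat.of R M) ∧
      (∀ i : ℤ, Module.Finite R (P.X i) ∧ Module.Projective R (P.X i)) ∧
      (Nontrivial M → ∃ k : ℕ,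
        QuasiProjective.qpd (ModuleCat.of R M) = (k : ℕ∞) ∧
        QuasiProjective.complexSup P - QuasiProjective.complexHSup P = (k : ℤ))) ∧
    (∃ (N : Type u) (_ : AddCommGroup N) (_ : Module R N),
      Module.FinitePresentation R N ∧
      QuasiProjective.pd (ModuleCat.of R N) = QuasiProjective.qpd (ModuleCat.of R M) ∧
      ∃ f : M →ₗ[R] N, Function.Injective f) := by
  by_cases h0 : IsZero (ModuleCat.of R M)
  · have hq : QuasiProjective.qpd (ModuleCat.of R M) = 0 := by
      rw [QuasiProjective.qpd, if_pos h0]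
    have hsub : Subsingleton M := ModuleCat.subsingleton_of_isZero h0
    obtain ⟨Z, hZ⟩ := HasZeroObject.zero (C := ChainComplex (ModuleCat.{u} R) ℤ)
    have hZi (i : ℤ) : IsZero (Z.X i) :=
      (HomologicalComplex.eval (ModuleCat.{u} R) (ComplexShape.down ℤ) i).map_isZero hZ
    refine ⟨⟨Z, QuasiProjective.isFiniteQuasiProjectiveResolution_of_isZero h0 hZi, fun i => ?_,
      fun hnt => (not_subsingleton M hsub).elim⟩, M, inferInstance, inferInstance, hM, ?_,
      LinearMap.id, Function.injective_id⟩
    · have := ModuleCat.subsingleton_of_isZero (hZi i)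
      exact ⟨inferInstance, inferInstance⟩
    · rw [hq, QuasiProjective.pd, (projectiveDimension_eq_bot_iff _).2 h0]
      rfl
  · obtain ⟨P, k, hP, hk, hq⟩ := QuasiProjective.exists_resolution_qpd_eq h0 hqpd
    have hPres := hP.toIsQuasiProjectiveResolution
    obtain ⟨a, ha⟩ := hP.boundedBelow
    obtain ⟨b, hb⟩ := hP.boundedAbove
    obtain ⟨j, hj⟩ := hPres.exists_homology_ne_zero h0
    have hj' : ¬ IsZero (P.X j) := fun h => hj (QuasiProjective.isZero_homology_of_isZero_X h)
    obtain ⟨-, hs⟩ := QuasiProjective.complexSup_spec hb ⟨j, hj'⟩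
    have haj : a ≤ j := not_lt.1 fun h => hj' (ha j h)
    have hjs : j ≤ QuasiProjective.complexSup P := not_lt.1 fun h => hj' (hs j h)
    have hfp : Module.FinitePresentation R (ModuleCat.of R M) := hM
    obtain ⟨X, π, hπ, hX, hfin, hXa, hXs⟩ := hR.exists_quasiIso_finite P hPres.projective
      (haj.trans hjs) ha hs hPres.finitePresentation_homology
    have e (i : ℤ) : Nonempty (X.homology i ≅ P.homology i) := ⟨isoOfQuasiIsoAt π i⟩
    have hXres := hPres.of_homology_iso e hX ⟨a, hXa⟩
    have hsup := QuasiProjective.complexHSup_congr e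
    have hXk (i : ℤ) (hi : QuasiProjective.complexHSup X + k < i) : IsZero (X.X i) :=
      hXs i (by omega)
    have hXfp (i : ℤ) : Module.Finite R (X.X i) ∧ Module.Projective R (X.X i) :=
      ⟨hfin i, (IsProjective.iff_projective _).2 (hX i)⟩
    obtain ⟨k', hk', hdiff, hle⟩ := hXres.exists_qpd_le h0 hXk
    rw [hq, Nat.cast_le] at hle
    -- The replacement could only have lowered `sup`; minimality of `k` excludes that.
    obtain rfl : k' = k := le_antisymm hk' hle
    obtain ⟨hH, -⟩ := QuasiProjective.complexHSup_spec
      (fun i hi => QuasiProjective.isZero_homology_of_isZero_X (hXs i hi))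
      (hXres.exists_homology_ne_zero h0)
    obtain ⟨f, hf⟩ := hXres.exists_injective_homology hH
    have hι := (ModuleCat.mono_iff_injective
      (X.homologyι (QuasiProjective.complexHSup X))).1 inferInstance
    refine ⟨⟨X, ⟨hXres, _, hXs⟩, hXfp, fun _ => ⟨k', hq, hdiff⟩⟩,
      X.opcycles (QuasiProjective.complexHSup X), inferInstance, inferInstance,
      QuasiProjective.finitePresentation_opcycles X hXfp _, ?_,
      (X.homologyι _).hom ∘ₗ f,
      hι.comp hf⟩
    rw [hq]
    exact hXres.pd_opcycles h0 hXk hq
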